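/- Let $K$ be a field, $n\ge 0$, and $R=K[x_0,\dots,x_n]$ the standard graded polynomial ring with graded maximal ideal $\mathfrak m=\langle x_0,\dots,x_n\rangle$. Let $f_1,\dots,f_s\in R$ be forms (homogeneous polynomials) that are generic, i.e. for every $r\le n+1$ and all $1\le i_1<\dots<i_r\le s$, the forms $f_{i_1},\dots,f_{i_r}$ are an $R$-regular sequence (in particular they generate a proper ideal). Let $a,m_1,\dots,m_s$ be positive integers with $a\le m_1+\dots+m_s$, and put $$I_a(f_1^{m_1}\cdots f_s^{m_s})=\Big\langle f_1^{n_1}\cdots f_s^{n_s} : 0\le n_i\le m_i \text{ for all } i,\ \sum_{i=1}^s n_i=a\Big\rangle\subseteq R .$$ For an ideal $I\subseteq R$ let $I^{\mathrm{sat}}=\bigcup_{k\ge 0}(I:\mathfrak m^k)$ be its saturation. Then $$I_a(f_1^{m_1}\cdots f_s^{m_s})^{\mathrm{sat}}=\bigcap_{c=1}^{n}\ \bigcap_{1\le i_1<\dots<i_c\le s}\langle f_{i_1},\dots,f_{i_c}\rangle^{\mu_a(i_1,\dots,i_c)},\qquad \mu_a(i_1,\dots,i_c)=\max\Big(0,\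 a-\sum_{j\in\{1,\dots,s\}\setminus\{i_1,\dots,i_c\}}m_j\Big),$$ where the $0$-th power of an ideal is $R$ and an empty intersection is $R$. -/

import Mathlib

open scoped BigOperators

noncomputable section

namespace FoldProduct

/-- The saturation `I : 𝔪^∞ = ⋃ₖ (I : 𝔪^k)` of an ideal `I` of `K[x_i : i ∈ σ]` with respect to the
graded maximal ideal `𝔪 = ⟨x_i : i ∈ σ⟩`: the `g` with `g 𝔪^k ⊆ I` for some `k`.
(The colon ideals increase with `k`, so their union is their supremum.) -/
def saturation {K σ : Type*} [Field K] (I : Ideal (MvPolynomial σ K)) :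
    Ideal (MvPolynomial σ K) :=
  ⨆ k : ℕ, Submodule.colon I
    ((MvPolynomial.idealOfVars σ K ^ k : Ideal (MvPolynomial σ K)) : Set (MvPolynomial σ K))

/-- `f_1, …, f_s` are `c`-generic: for all indices `i_1 < ⋯ < i_r` with `r ≤ c + 1`, the elements
`f_{i_1}, …, f_{i_r}` form a regular sequence (Mathlib's `IsRegular` includes
`⟨f_{i_1}, …, f_{i_r}⟩ ≠ R`). -/
def IsGeneric {R : Type*} [CommRing R] {s : ℕ} (c : ℕ) (f : Fin s → R) : Prop :=
  ∀ t : Finset (Fin s), t.card ≤ c + 1 →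
    RingTheory.Sequence.IsRegular R ((t.sort (· ≤ ·)).map f)

/-- The `a`-fold product ideal `I_a(f_1^{m_1} ⋯ f_s^{m_s})`, generated by the products
`f_1^{n_1} ⋯ f_s^{n_s}` with `0 ≤ n_i ≤ m_i` and `∑ n_i = a`. -/
def foldProductIdeal {R : Type*} [CommRing R] {s : ℕ} (f : Fin s → R) (m : Fin s → ℕ) (a : ℕ) :
    Ideal R :=
  Ideal.span {g | ∃ e : Fin s → ℕ, (∀ i, e i ≤ m i) ∧ ∑ i, e i = a ∧ g = ∏ i, f i ^ e i}

/-- `μ_a(i_1, …, i_c) = max(0, a - ∑_{j ∉ {i_1, …, i_c}} m_j)`, for `t = {i_1, …, i_c}`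
(subtraction of natural numbers truncates at `0`). -/
def mu {s : ℕ} (m : Fin s → ℕ) (a : ℕ) (t : Finset (Fin s)) : ℕ :=
  a - ∑ j ∈ tᶜ, m j

end FoldProduct

end

/-! Write `f_t` for the ideal generated by the `f i` with `i ∈ t`, and `𝔪` for the irrelevant ideal.
For `⊆`, a generator of the fold product ideal spends at most `m j` on each `j ∉ t`, so it lies in
`f_t ^ mu m a t`. For `|t| ≤ n` the quotient by `f_t` has positive depth along `𝔪`
(`HasDepth.sup_span`), so `f_t` is `𝔪`-saturated, and so are its powers
(`IsPermutablyRegularMod.isSaturatedBy_pow`). For `⊇`, let `g` lie in the intersection and `|t| ≤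
n`. The powers for the subsets of `t` put `g` in the fold product ideal of the regular family `f_t`
in degree `mu m a t` (`IsPermutablyRegularMod.mem_sup_partialFoldIdeal`), so `g * ∏ i ∈ tᶜ, f i ^ m
i` lies in the full fold product ideal. A prime containing all these complementary products contains
more than `n` of the forms, hence contains `𝔪` by a height count. So the products generate an ideal
containing a power of `𝔪`, and that power multiplies `g` into the fold product ideal. -/

namespace FoldProduct

/-! ### Powers and fold products of permutable regular sequences. -/

section RegularModulo

variable {R ι : Type*} [CommRing R]

/-- Multiplication by the elements of `S` jointly detects zero in `R ⧸ J`, that is, `(J : S) = J`. -/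
def IsSaturatedBy (S : Set R) (J : Ideal R) : Prop :=
  ∀ u, (∀ h ∈ S, h * u ∈ J) → u ∈ J

/-- The element `x` is a nonzerodivisor on `R ⧸ J`. -/
def IsRegularMod (J : Ideal R) (x : R) : Prop :=
  ∀ u, x * u ∈ J → u ∈ J

lemma IsRegularMod.isSaturatedBy {J : Ideal R} {x : R} (h : IsRegularMod J x) {S : Set R}
    (hx : x ∈ S) : IsSaturatedBy S J :=
  fun u hu => h u (hu x hx)

/-- In the family `f`, restricted to `t`, each element is a nonzerodivisor modulo `J` and any set of
the others. -/
def IsPermutablyRegularMod (f : ι → R) (J : Ideal R) (t : Finset ι) : Prop :=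
  ∀ t' ⊆ t, ∀ j ∈ t, j ∉ t' → IsRegularMod (J ⊔ Ideal.span (f '' (t' : Set ι))) (f j)

lemma IsPermutablyRegularMod.mono {f : ι → R} {J : Ideal R} {t t' : Finset ι}
    (h : IsPermutablyRegularMod f J t) (ht : t' ⊆ t) : IsPermutablyRegularMod f J t' :=
  fun t₁ h₁ j hj hj' => h t₁ (h₁.trans ht) j (ht hj) hj'

lemma span_image_insert [DecidableEq ι] (f : ι → R) (i : ι) (t : Finset ι) :
    Ideal.span (f '' ((insert i t : Finset ι) : Set ι)) =
      Ideal.span {f i} ⊔ Ideal.span (f '' (t : Set ι)) := by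
  rw [Finset.coe_insert, Set.image_insert_eq, Ideal.span_insert]

lemma IsPermutablyRegularMod.sup_span [DecidableEq ι] {f : ι → R} {J : Ideal R} {t : Finset ι}
    {i : ι} (hi : i ∉ t) (h : IsPermutablyRegularMod f J (insert i t)) :
    IsPermutablyRegularMod f (J ⊔ Ideal.span {f i}) t := by
  intro t' ht' j hj hj'
  rw [sup_assoc, ← span_image_insert]
  refine h _ (Finset.insert_subset_insert i ht') j (Finset.mem_insert_of_mem hj) ?_
  rw [Finset.mem_insert, not_or]
  exact ⟨fun e => hi (e ▸ hj), hj'⟩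

lemma sup_pow_succ_le (A B : Ideal R) (n : ℕ) :
    (A ⊔ B) ^ (n + 1) ≤ A * (A ⊔ B) ^ n ⊔ B ^ (n + 1) := by
  induction n with
  | zero => simp
  | succ n ih =>
    rw [pow_succ' _ (n + 1), Ideal.sup_mul]
    refine sup_le le_sup_left ((Ideal.mul_mono_right ih).trans ?_)
    rw [Ideal.mul_sup, ← pow_succ']
    refine sup_le (le_sup_of_le_left ?_) le_sup_right
    rw [mul_left_comm]
    refine Ideal.mul_mono_right ?_
    rw [pow_succ']
    exact Ideal.mul_mono_left le_sup_right

lemma sup_sup_pow_le (J A B : Ideal R) (n : ℕ) : J ⊔ (A ⊔ B) ^ n ≤ (J ⊔ A) ⊔ B ^ n := by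
  refine sup_le (le_sup_left.trans le_sup_left) ?_
  cases n with
  | zero => simp
  | succ n =>
    refine (sup_pow_succ_le A B n).trans (sup_le_sup_right ?_ _)
    exact (Ideal.mul_le_left : A * (A ⊔ B) ^ n ≤ A).trans le_sup_right

lemma span_image_empty (f : ι → R) : Ideal.span (f '' ((∅ : Finset ι) : Set ι)) = ⊥ := by
  rw [Finset.coe_empty, Set.image_empty, Ideal.span_empty]

lemma span_image_empty_pow_succ (f : ι → R) (k : ℕ) :
    Ideal.span (f '' ((∅ : Finset ι) : Set ι)) ^ (k + 1) = ⊥ := by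
  rw [span_image_empty, ← Ideal.zero_eq_bot, zero_pow k.succ_ne_zero]

/-- Cancelling `f i` costs one power, as for a variable in a polynomial ring: terms of the power
involving `f i` are `f i * v` with `v` in the `k`-th power, and the regularity hypothesis controls
`u - v`. -/
lemma mem_sup_pow_of_mul_mem [DecidableEq ι] {f : ι → R} {J : Ideal R} {t : Finset ι} {i : ι} {k : ℕ}
    (h : IsRegularMod (J ⊔ Ideal.span (f '' (t : Set ι)) ^ (k + 1)) (f i)) {u : R}
    (hu : f i * u ∈ J ⊔ Ideal.span (f '' ((insert i t : Finset ι) : Set ι)) ^ (k + 1)) :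
    u ∈ J ⊔ Ideal.span (f '' ((insert i t : Finset ι) : Set ι)) ^ k := by
  rw [span_image_insert] at hu ⊢
  set A := Ideal.span {f i}
  set B := Ideal.span (f '' (t : Set ι))
  have h1 : f i * u ∈ (J ⊔ B ^ (k + 1)) ⊔ A * (A ⊔ B) ^ k := by
    refine (sup_le (le_sup_of_le_left le_sup_left) ?_ : J ⊔ (A ⊔ B) ^ (k + 1) ≤ _) hu
    exact (sup_pow_succ_le A B k).trans (sup_le le_sup_right (le_sup_of_le_left le_sup_right))
  obtain ⟨p, hp, q, hq, hpq⟩ := Submodule.mem_sup.mp h1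
  obtain ⟨v, hv, rfl⟩ := Ideal.mem_span_singleton_mul.mp hq
  have h2 : u - v ∈ J ⊔ B ^ (k + 1) := by
    refine h _ ?_
    rwa [mul_sub, ← hpq, add_sub_cancel_right]
  have h3 : u - v ∈ J ⊔ (A ⊔ B) ^ k :=
    sup_le_sup_left ((Ideal.pow_le_pow_right k.le_succ).trans
      (Ideal.pow_right_mono le_sup_right k)) J h2
  simpa using Ideal.add_mem _ h3 ((le_sup_right : (A ⊔ B) ^ k ≤ J ⊔ _) hv)

/-- Powers of an ideal generated by a permutable regular sequence inherit saturatedness. -/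
theorem IsPermutablyRegularMod.isSaturatedBy_pow [DecidableEq ι] {f : ι → R} {t : Finset ι}
    {J : Ideal R} (hN : IsPermutablyRegularMod f J t) {S : Set R}
    (hS : IsSaturatedBy S (J ⊔ Ideal.span (f '' (t : Set ι)))) (k : ℕ) :
    IsSaturatedBy S (J ⊔ Ideal.span (f '' (t : Set ι)) ^ k) := by
  induction t using Finset.induction_on generalizing J S k with
  | empty =>
    cases k with
    | zero => intro u _; simp
    | succ k => rwa [span_image_empty_pow_succ, ← span_image_empty f]
  | insert i t hi ih =>
    -- Arbitrary `S` pays off here: with `S = {f i}` the induction hypothesis makes `f i` regular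
    -- modulo powers.
    have hreg (k : ℕ) : IsRegularMod (J ⊔ Ideal.span (f '' (t : Set ι)) ^ k) (f i) := by
      intro u hu
      refine ih (hN.mono (Finset.subset_insert i t)) (S := {f i}) ?_ k u (by simpa using hu)
      exact (hN t (Finset.subset_insert i t) i (Finset.mem_insert_self i t) hi).isSaturatedBy rfl
    induction k with
    | zero => intro u _; simp
    | succ k ihk =>
      intro u hu
      have h1 : IsSaturatedBy S ((J ⊔ Ideal.span {f i}) ⊔ Ideal.span (f '' (t : Set ι)) ^ (k + 1)) :=
        ih (hN.sup_span hi) (by rwa [sup_assoc, ← span_image_insert]) (k + 1)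
      have h2 : J ⊔ Ideal.span (f '' ((insert i t : Finset ι) : Set ι)) ^ (k + 1) ≤
          (J ⊔ Ideal.span {f i}) ⊔ Ideal.span (f '' (t : Set ι)) ^ (k + 1) := by
        rw [span_image_insert]
        exact sup_sup_pow_le _ _ _ _
      have h3 := h1 u fun h hh => h2 (hu h hh)
      rw [sup_right_comm] at h3
      -- Modulo `f i` the claim is known, so `u = v + w * f i`; it remains to place `w` one power
      -- lower.
      obtain ⟨v, hv, q, hq, rfl⟩ := Submodule.mem_sup.mp h3
      obtain ⟨w, rfl⟩ := Ideal.mem_span_singleton'.mp hq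
      have hv' : v ∈ J ⊔ Ideal.span (f '' ((insert i t : Finset ι) : Set ι)) ^ (k + 1) := by
        refine sup_le_sup_left (Ideal.pow_right_mono ?_ _) J hv
        rw [span_image_insert]
        exact le_sup_right
      refine Ideal.add_mem _ hv' ?_
      have hw : w ∈ J ⊔ Ideal.span (f '' ((insert i t : Finset ι) : Set ι)) ^ k := by
        refine ihk w fun h hh => mem_sup_pow_of_mul_mem (hreg _) ?_
        have := Ideal.sub_mem _ (hu h hh) (Ideal.mul_mem_left _ h hv')
        convert this using 1
        ring
      obtain ⟨a, ha, b, hb, rfl⟩ := Submodule.mem_sup.mp hw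
      rw [add_mul]
      refine Ideal.add_mem _ (Ideal.mul_mem_right _ _ (Ideal.mem_sup_left ha)) (Ideal.mem_sup_right ?_)
      rw [pow_succ]
      exact Ideal.mul_mem_mul hb (Ideal.subset_span ⟨i, by simp, rfl⟩)

lemma IsPermutablyRegularMod.isRegularMod_pow [DecidableEq ι] {f : ι → R} {t : Finset ι}
    {J : Ideal R} {i : ι} (hi : i ∉ t) (hN : IsPermutablyRegularMod f J (insert i t)) (k : ℕ) :
    IsRegularMod (J ⊔ Ideal.span (f '' (t : Set ι)) ^ k) (f i) := by
  intro u hu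
  refine (hN.mono (Finset.subset_insert i t)).isSaturatedBy_pow (S := {f i}) ?_ k u
    (by simpa using hu)
  exact (hN t (Finset.subset_insert i t) i (Finset.mem_insert_self i t) hi).isSaturatedBy rfl

/-- The ideal generated by the products `∏ i ∈ t, f i ^ e i` with `e ≤ m` and `∑ i ∈ t, e i = b`. -/
def partialFoldIdeal (f : ι → R) (m : ι → ℕ) (t : Finset ι) (b : ℕ) : Ideal R :=
  Ideal.span {g | ∃ e : ι → ℕ, (∀ i ∈ t, e i ≤ m i) ∧ ∑ i ∈ t, e i = b ∧ g = ∏ i ∈ t, f i ^ e i}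

lemma pow_mul_partialFoldIdeal_le [DecidableEq ι] {f : ι → R} {m m' : ι → ℕ} {t : Finset ι} {i : ι}
    (hi : i ∉ t) {k b : ℕ} (hk : k ≤ m' i) (hm : ∀ j ∈ t, m j ≤ m' j) :
    Ideal.span {f i ^ k} * partialFoldIdeal f m t b ≤ partialFoldIdeal f m' (insert i t) (k + b) := by
  rw [partialFoldIdeal, Ideal.span_singleton_mul_le_iff]
  intro z hz
  induction hz using Submodule.span_induction with
  | zero => simp
  | add x y _ _ hx hy => rw [mul_add]; exact Ideal.add_mem _ hx hy
  | smul a x _ hx => rw [smul_eq_mul, mul_left_comm]; exact Ideal.mul_mem_left _ _ hx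
  | mem g hg =>
    obtain ⟨e, he, hsum, rfl⟩ := hg
    have hne : ∀ j ∈ t, j ≠ i := fun j hj h => hi (h ▸ hj)
    refine Ideal.subset_span ⟨Function.update e i k, ?_, ?_, ?_⟩
    · intro j hj
      rcases Finset.mem_insert.mp hj with rfl | hj
      · simpa using hk
      · rw [Function.update_of_ne (hne j hj)]
        exact (he j hj).trans (hm j hj)
    · rw [Finset.sum_insert hi, Finset.sum_update_of_notMem hi, hsum, Function.update_self]
    · rw [Finset.prod_insert hi, Function.update_self]
      congr 1
      exact Finset.prod_congr rfl fun j hj => by rw [Function.update_of_ne (hne j hj)]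

lemma span_mul_partialFoldIdeal_le [DecidableEq ι] {f : ι → R} {m : ι → ℕ} {t : Finset ι} {i : ι}
    (hi : i ∈ t) {b : ℕ} (hm : 0 < m i) :
    Ideal.span {f i} * partialFoldIdeal f (Function.update m i (m i - 1)) t b ≤
      partialFoldIdeal f m t (b + 1) := by
  rw [partialFoldIdeal, Ideal.span_singleton_mul_le_iff]
  intro z hz
  induction hz using Submodule.span_induction with
  | zero => simp
  | add x y _ _ hx hy => rw [mul_add]; exact Ideal.add_mem _ hx hy
  | smul a x _ hx => rw [smul_eq_mul, mul_left_comm]; exact Ideal.mul_mem_left _ _ hx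
  | mem g hg =>
    obtain ⟨e, he, hsum, rfl⟩ := hg
    refine Ideal.subset_span ⟨fun j => e j + if j = i then 1 else 0, ?_, ?_, ?_⟩
    · intro j hj
      have := he j hj
      by_cases h : j = i
      · subst h
        simp only [Function.update_self] at this
        simp only [if_true]
        omega
      · simpa [Function.update_of_ne h, h] using this
    · rw [Finset.sum_add_distrib, hsum, Finset.sum_ite_eq' t i, if_pos hi]
    · simp only [pow_add, Finset.prod_mul_distrib, pow_ite, pow_one, pow_zero,
        Finset.prod_ite_eq' t i, if_pos hi]
      rw [mul_comm]

lemma partialFoldIdeal_zero (f : ι → R) (m : ι → ℕ) (t : Finset ι) :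
    partialFoldIdeal f m t 0 = ⊤ :=
  (Ideal.eq_top_iff_one _).mpr (Ideal.subset_span ⟨0, by simp⟩)

lemma prod_pow_mem_span_pow (f : ι → R) (t : Finset ι) (e : ι → ℕ) :
    ∏ i ∈ t, f i ^ e i ∈ Ideal.span (f '' (t : Set ι)) ^ ∑ i ∈ t, e i := by
  rw [← Finset.prod_pow_eq_pow_sum]
  exact Ideal.prod_mem_prod fun i hi =>
    Ideal.pow_mem_pow (Ideal.subset_span (Set.mem_image_of_mem f hi)) _

lemma partialFoldIdeal_le_span_pow [DecidableEq ι] (f : ι → R) (m : ι → ℕ) {t t' : Finset ι}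
    (h : t' ⊆ t) (b : ℕ) :
    partialFoldIdeal f m t b ≤ Ideal.span (f '' (t' : Set ι)) ^ (b - ∑ j ∈ t \ t', m j) := by
  refine Ideal.span_le.mpr ?_
  rintro g ⟨e, he, rfl, rfl⟩
  rw [← Finset.prod_sdiff h, ← Finset.sum_sdiff h]
  refine Ideal.mul_mem_left _ _ (Ideal.pow_le_pow_right ?_ (prod_pow_mem_span_pow f t' e))
  have : ∑ i ∈ t \ t', e i ≤ ∑ i ∈ t \ t', m i :=
    Finset.sum_le_sum fun i hi => he i (Finset.mem_sdiff.mp hi).1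
  omega

/-- A fold product ideal of a permutable regular sequence contains the intersection of suitable
powers of the ideals generated by its subsequences. -/
theorem IsPermutablyRegularMod.mem_sup_partialFoldIdeal [DecidableEq ι] {f : ι → R} {t : Finset ι}
    {J : Ideal R} (hN : IsPermutablyRegularMod f J t) {m : ι → ℕ} {b : ℕ} {g : R}
    (hg : ∀ t' ⊆ t, g ∈ J ⊔ Ideal.span (f '' (t' : Set ι)) ^ (b - ∑ j ∈ t \ t', m j)) :
    g ∈ J ⊔ partialFoldIdeal f m t b := by
  induction t using Finset.induction_on generalizing J b m g with
  | empty =>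
    cases b with
    | zero =>
      simp [partialFoldIdeal_zero]
    | succ b =>
      refine Ideal.mem_sup_left ?_
      have := hg ∅ subset_rfl
      rwa [sdiff_self, Finset.bot_eq_empty, Finset.sum_empty, Nat.sub_zero,
        span_image_empty_pow_succ, sup_bot_eq] at this
  | insert i t hi ih =>
    have hsub (t' : Finset ι) (ht' : t' ⊆ t) (m : ι → ℕ) :
        ∑ j ∈ insert i t \ t', m j = m i + ∑ j ∈ t \ t', m j := by
      rw [Finset.insert_sdiff_of_notMem _ fun h => hi (ht' h), Finset.sum_insert]
      simp [hi]
    have hins (t' : Finset ι) (m : ι → ℕ) :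
        ∑ j ∈ insert i t \ insert i t', m j = ∑ j ∈ t \ t', m j := by
      rw [Finset.insert_sdiff_insert, Finset.sdiff_insert_of_notMem hi]
    generalize hk : m i = k
    -- Inner induction on the multiplicity of `f i`: dividing by `f i` lowers both `m i` and `b` by
    -- one.
    induction k generalizing m b g with
    | zero =>
      have h1 : g ∈ J ⊔ partialFoldIdeal f m t b := by
        refine ih (hN.mono (Finset.subset_insert i t)) fun t' ht' => ?_
        have := hg t' (ht'.trans (Finset.subset_insert i t))
        rwa [hsub t' ht', hk, zero_add] at this
      refine sup_le_sup_left ?_ J h1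
      have := pow_mul_partialFoldIdeal_le (f := f) (m := m) (m' := m) hi (k := 0) (b := b)
        (Nat.zero_le _) (fun _ _ => le_rfl)
      simpa using this
    | succ k ihk =>
      have h1 : g ∈ (J ⊔ Ideal.span {f i}) ⊔ partialFoldIdeal f m t b := by
        refine ih (hN.sup_span hi) fun t' ht' => ?_
        have := hg (insert i t') (Finset.insert_subset_insert i ht')
        rw [hins] at this
        refine (?_ : J ⊔ Ideal.span (f '' ((insert i t' : Finset ι) : Set ι)) ^ _ ≤ _) this
        rw [span_image_insert]
        exact sup_sup_pow_le _ _ _ _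
      rw [sup_right_comm] at h1
      obtain ⟨v, hv, q, hq, rfl⟩ := Submodule.mem_sup.mp h1
      obtain ⟨h, rfl⟩ := Ideal.mem_span_singleton.mp hq
      cases b with
      | zero => simp [partialFoldIdeal_zero]
      | succ b =>
        have hle : partialFoldIdeal f m t (b + 1) ≤ partialFoldIdeal f m (insert i t) (b + 1) := by
          simpa using pow_mul_partialFoldIdeal_le (f := f) (m := m) (m' := m) hi (k := 0)
            (b := b + 1) (Nat.zero_le _) (fun _ _ => le_rfl)
        have hv' := sup_le_sup_left hle J hv
        refine Ideal.add_mem _ hv' ?_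
        have hsum' (t' : Finset ι) :
            ∑ j ∈ t \ t', Function.update m i k j = ∑ j ∈ t \ t', m j :=
          Finset.sum_update_of_notMem (fun h => hi (Finset.mem_sdiff.mp h).1) _ _
        -- The summand `v` already satisfies every membership condition, so `f i * h` inherits them
        -- from `g`.
        have hfh (t' : Finset ι) (ht' : t' ⊆ insert i t) :
            f i * h ∈ J ⊔ Ideal.span (f '' (t' : Set ι)) ^
              (b + 1 - ∑ j ∈ insert i t \ t', m j) := by
          have h2 := Ideal.sub_mem _ (hg t' ht')
            (sup_le_sup_left (partialFoldIdeal_le_span_pow f m ht' (b + 1)) J hv')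
          rwa [add_sub_cancel_left] at h2
        have hh : h ∈ J ⊔ partialFoldIdeal f (Function.update m i k) (insert i t) b := by
          refine ihk (fun t' ht' => ?_) (Function.update_self _ _ _)
          -- If `i ∈ t'`, cancelling `f i` lowers the exponent by one, matching `b`. If `i ∉ t'`,
          -- the drops of `b` and `m i` offset each other and `f i` is regular modulo the power.
          by_cases hit : i ∈ t'
          · obtain ⟨t', hit', rfl⟩ : ∃ t'', i ∉ t'' ∧ insert i t'' = t' :=
              ⟨t'.erase i, Finset.notMem_erase _ _, Finset.insert_erase hit⟩
            have h3 := hfh _ ht'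
            rw [hins] at h3 ⊢
            rw [hsum']
            rcases Nat.lt_or_ge b (∑ j ∈ t \ t', m j) with hlt | hge
            · rw [Nat.sub_eq_zero_of_le hlt.le]
              simp
            · rw [Nat.sub_add_comm hge] at h3
              exact mem_sup_pow_of_mul_mem ((hN.mono ht').isRegularMod_pow hit' _) h3
          · have ht'' : t' ⊆ t := (Finset.subset_insert_iff_of_notMem hit).mp ht'
            have h3 := hfh _ ht'
            rw [hsub _ ht''] at h3 ⊢
            rw [hk, show b + 1 - (k + 1 + ∑ j ∈ t \ t', m j) = b - (k + ∑ j ∈ t \ t', m j) by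
              omega] at h3
            rw [hsum', Function.update_self]
            exact (hN.mono (Finset.insert_subset_insert i ht'')).isRegularMod_pow hit _ _ h3
        obtain ⟨p, hp, r, hr, rfl⟩ := Submodule.mem_sup.mp hh
        rw [mul_add]
        refine Ideal.add_mem _ (Ideal.mem_sup_left (Ideal.mul_mem_left _ _ hp))
          (Ideal.mem_sup_right ?_)
        refine span_mul_partialFoldIdeal_le (Finset.mem_insert_self i t) (by omega) ?_
        rw [hk, Nat.add_sub_cancel]
        exact Ideal.mul_mem_mul (Ideal.mem_span_singleton_self _) hr

end RegularModulo

/-! ### Depth, exchange of regular elements, and height. -/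

section Depth

variable {R ι : Type*} [CommRing R]

/-- This half of permuting a regular pair `z, w` needs no local hypothesis. -/
lemma IsRegularMod.swap {J : Ideal R} {z w : R} (hz : IsRegularMod J z)
    (hw : IsRegularMod (J ⊔ Ideal.span {z}) w) : IsRegularMod (J ⊔ Ideal.span {w}) z := by
  intro u hu
  obtain ⟨j, hj, q, hq, h1⟩ := Submodule.mem_sup.mp hu
  obtain ⟨v, rfl⟩ := Ideal.mem_span_singleton.mp hq
  have hv : v ∈ J ⊔ Ideal.span {z} := by
    refine hw v ?_
    rw [← sub_eq_of_eq_add' h1.symm]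
    exact Ideal.sub_mem _ (Ideal.mem_sup_right (Ideal.mul_mem_right _ _
      (Ideal.mem_span_singleton_self z))) (Ideal.mem_sup_left hj)
  obtain ⟨j', hj', q', hq', rfl⟩ := Submodule.mem_sup.mp hv
  obtain ⟨v', rfl⟩ := Ideal.mem_span_singleton.mp hq'
  have h2 : u - w * v' ∈ J := by
    refine hz _ ?_
    have : z * (u - w * v') = j + w * j' := by rw [mul_sub, ← h1]; ring
    rw [this]
    exact Ideal.add_mem _ hj (Ideal.mul_mem_left _ _ hj')
  simpa using Ideal.add_mem _ (Ideal.mem_sup_left h2) (Ideal.mem_sup_right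
    (Ideal.mul_mem_right v' _ (Ideal.mem_span_singleton_self w)) : w * v' ∈ J ⊔ Ideal.span {w})

/-- Saturatedness modulo a regular element does not depend on the element. -/
lemma IsSaturatedBy.exchange {J : Ideal R} {S : Set R} {y z : R} (hyS : y ∈ S)
    (hy : IsRegularMod J y) (hz : IsRegularMod J z)
    (h : IsSaturatedBy S (J ⊔ Ideal.span {y})) : IsSaturatedBy S (J ⊔ Ideal.span {z}) := by
  intro u hu
  -- The relation `y * u ≡ z * v` modulo `J` carries elements killed by `S` modulo `z` to elements
  -- killed by `S` modulo `y`.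
  obtain ⟨j, hj, q, hq, h1⟩ := Submodule.mem_sup.mp (hu y hyS)
  obtain ⟨v, rfl⟩ := Ideal.mem_span_singleton.mp hq
  have hv : v ∈ J ⊔ Ideal.span {y} := by
    refine h v fun s hs => ?_
    obtain ⟨j', hj', q', hq', h2⟩ := Submodule.mem_sup.mp (hu s hs)
    obtain ⟨v', rfl⟩ := Ideal.mem_span_singleton.mp hq'
    have h3 : s * v - y * v' ∈ J := by
      refine hz _ ?_
      have : z * (s * v - y * v') = y * j' - s * j := by linear_combination s * h1 - y * h2
      rw [this]
      exact Ideal.sub_mem _ (Ideal.mul_mem_left _ _ hj') (Ideal.mul_mem_left _ _ hj)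
    simpa using Ideal.add_mem _ (Ideal.mem_sup_left h3) (Ideal.mem_sup_right
      (Ideal.mul_mem_right v' _ (Ideal.mem_span_singleton_self y)) : y * v' ∈ J ⊔ Ideal.span {y})
  obtain ⟨j', hj', q', hq', rfl⟩ := Submodule.mem_sup.mp hv
  obtain ⟨v', rfl⟩ := Ideal.mem_span_singleton.mp hq'
  have h2 : u - z * v' ∈ J := by
    refine hy _ ?_
    have : y * (u - z * v') = j + z * j' := by linear_combination -h1
    rw [this]
    exact Ideal.add_mem _ hj (Ideal.mul_mem_left _ _ hj')
  simpa using Ideal.add_mem _ (Ideal.mem_sup_left h2) (Ideal.mem_sup_right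
    (Ideal.mul_mem_right v' _ (Ideal.mem_span_singleton_self z)) : z * v' ∈ J ⊔ Ideal.span {z})

/-- Prime avoidance: saturatedness keeps `I` out of each of the finitely many associated primes of
both quotients. -/
lemma exists_isRegularMod_of_isSaturatedBy [IsNoetherianRing R] {I J₁ J₂ : Ideal R}
    (h₁ : IsSaturatedBy I J₁) (h₂ : IsSaturatedBy I J₂) :
    ∃ w ∈ I, IsRegularMod J₁ w ∧ IsRegularMod J₂ w := by
  have key (J : Ideal R) (w : R) (hw : ¬ IsRegularMod J w) :
      ∃ p ∈ associatedPrimes R (R ⧸ J), w ∈ p := by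
    obtain ⟨u, hu, hu'⟩ : ∃ u, w * u ∈ J ∧ u ∉ J := by simpa [IsRegularMod] using hw
    have : w ∈ ⋃ p ∈ associatedPrimes R (R ⧸ J), (p : Set R) := by
      rw [biUnion_associatedPrimes_eq_zero_divisors]
      refine ⟨Ideal.Quotient.mk J u, by rwa [Ne, Ideal.Quotient.eq_zero_iff_mem], ?_⟩
      exact Ideal.Quotient.eq_zero_iff_mem.mpr hu
    simpa using this
  have key' (J : Ideal R) (hJ : IsSaturatedBy I J) (p : Ideal R)
      (hp : p ∈ associatedPrimes R (R ⧸ J)) : ¬ I ≤ p := by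
    intro hle
    obtain ⟨hp, x, rfl⟩ := isAssociatedPrime_iff.mp (AssociatedPrimes.mem_iff.mp hp)
    obtain ⟨u, rfl⟩ := Ideal.Quotient.mk_surjective x
    refine hp.ne_top ?_
    have hu : u ∈ J := by
      refine hJ u fun h hh => ?_
      have := hle hh
      rw [Submodule.mem_colon_singleton, Submodule.mem_bot] at this
      exact Ideal.Quotient.eq_zero_iff_mem.mp this
    rw [Ideal.Quotient.eq_zero_iff_mem.mpr hu, Ideal.eq_top_iff_one,
      Submodule.mem_colon_singleton]
    simp
  classical
  by_contra! hcon
  let s := (associatedPrimes.finite R (R ⧸ J₁)).toFinset ∪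
    (associatedPrimes.finite R (R ⧸ J₂)).toFinset
  have hs : (I : Set R) ⊆ ⋃ p ∈ (s : Set (Ideal R)), (p : Set R) := by
    intro w hw
    rw [Set.mem_iUnion₂]
    by_cases hw₁ : IsRegularMod J₁ w
    · obtain ⟨p, hp, hwp⟩ := key J₂ w (hcon w hw hw₁)
      exact ⟨p, by simp [s, hp], hwp⟩
    · obtain ⟨p, hp, hwp⟩ := key J₁ w hw₁
      exact ⟨p, by simp [s, hp], hwp⟩
  have hprime : ∀ p ∈ s, p.IsPrime := by
    intro p hp
    rcases Finset.mem_union.mp hp with h | h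
    · exact ((Set.Finite.mem_toFinset _).mp h).isPrime
    · exact ((Set.Finite.mem_toFinset _).mp h).isPrime
  obtain ⟨p, hp, hle⟩ := (Ideal.subset_union_prime (f := id) ⊤ ⊤ fun i hi _ _ => hprime i hi).mp hs
  rcases Finset.mem_union.mp hp with h | h
  · exact key' J₁ h₁ p ((Set.Finite.mem_toFinset _).mp h) hle
  · exact key' J₂ h₂ p ((Set.Finite.mem_toFinset _).mp h) hle

/-- There is a weakly regular sequence of length `k` on `R ⧸ J` with elements in `I`. -/
def HasDepth (I : Ideal R) : ℕ → Ideal R → Prop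
  | 0, _ => True
  | k + 1, J => ∃ y ∈ I, IsRegularMod J y ∧ HasDepth I k (J ⊔ Ideal.span {y})

lemma HasDepth.isSaturatedBy {I J : Ideal R} {k : ℕ} (h : HasDepth I (k + 1) J) :
    IsSaturatedBy I J := by
  obtain ⟨y, hy, hreg, -⟩ := h
  exact hreg.isSaturatedBy hy

/-- The depth drops by at most one modulo any regular element. -/
theorem HasDepth.sup_span [IsNoetherianRing R] {I J : Ideal R} {k : ℕ} (h : HasDepth I (k + 1) J)
    {z : R} (hz : IsRegularMod J z) : HasDepth I k (J ⊔ Ideal.span {z}) := by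
  induction k generalizing J z with
  | zero => trivial
  | succ k ih =>
    obtain ⟨y, hyI, hy, hdep⟩ := h
    have hsat := hdep.isSaturatedBy
    -- An element `w ∈ I` regular modulo both `J + (y)` and `J + (z)` lets the depth pass from `y`
    -- to `w` and then to `z`.
    obtain ⟨w, hwI, hwy, hwz⟩ :=
      exists_isRegularMod_of_isSaturatedBy hsat (hsat.exchange hyI hy hz)
    have h1 : HasDepth I (k + 1) (J ⊔ Ideal.span {w}) := by
      refine ⟨y, hyI, hy.swap hwy, ?_⟩
      rw [sup_right_comm]
      exact ih hdep hwy
    refine ⟨w, hwI, hwz, ?_⟩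
    rw [sup_right_comm]
    exact ih h1 (hz.swap hwz)

lemma IsPermutablyRegularMod.hasDepth [IsNoetherianRing R] [DecidableEq ι] {f : ι → R} {I J : Ideal R}
    {t : Finset ι} (hN : IsPermutablyRegularMod f J t) {k : ℕ} (h : HasDepth I (t.card + k) J) :
    HasDepth I k (J ⊔ Ideal.span (f '' (t : Set ι))) := by
  induction t using Finset.induction_on generalizing k with
  | empty => rw [span_image_empty, sup_bot_eq]; simpa using h
  | insert i t hi ih =>
    rw [Finset.card_insert_of_notMem hi, add_assoc, add_comm 1 k] at h
    rw [span_image_insert, sup_comm (Ideal.span {f i}), ← sup_assoc]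
    exact (ih (hN.mono (Finset.subset_insert i t)) h).sup_span
      (hN t (Finset.subset_insert i t) i (Finset.mem_insert_self i t) hi)

/-- Each new element is a nonzerodivisor modulo the previous ones, so it avoids their minimal primes
and the height grows. -/
lemma IsPermutablyRegularMod.card_le_height [DecidableEq ι] {f : ι → R} {t : Finset ι}
    (hN : IsPermutablyRegularMod f ⊥ t) {p : Ideal R} [hp : p.IsPrime] (hfp : ∀ i ∈ t, f i ∈ p) :
    (t.card : ℕ∞) ≤ p.height := by
  induction t using Finset.induction_on generalizing p with
  | empty => simp
  | insert i t hi ih =>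
    have hle : Ideal.span (f '' (t : Set ι)) ≤ p := by
      rw [Ideal.span_le]
      rintro _ ⟨j, hj, rfl⟩
      exact hfp j (Finset.mem_insert_of_mem hj)
    obtain ⟨q, hq, hqp⟩ := Ideal.exists_minimalPrimes_le hle
    have : q.IsPrime := hq.1.1
    have hiq : f i ∉ q := by
      intro h
      obtain ⟨y, hy, hxy⟩ := Ideal.exists_mul_mem_of_mem_minimalPrimes hq h
      have := hN t (Finset.subset_insert i t) i (Finset.mem_insert_self i t) hi y
      rw [bot_sup_eq] at this
      exact hy (this hxy)
    have hlt : q < p := lt_of_le_of_ne hqp fun h => hiq (h ▸ hfp i (Finset.mem_insert_self i t))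
    have h1 := ih (hN.mono (Finset.subset_insert i t)) (p := q) fun j hj =>
      hq.1.2 (Ideal.subset_span ⟨j, hj, rfl⟩)
    rw [Finset.card_insert_of_notMem hi]
    push_cast
    exact (add_le_add_left h1 1).trans (Ideal.height_add_one_le_of_lt_of_isPrime hlt)

end Depth

/-! ### Genericity gives regularity in every order. -/

section Generic

variable {R : Type*} [CommRing R] {s : ℕ}

lemma sort_insert_of_lt {t : Finset (Fin s)} {a : Fin s} (h : ∀ i ∈ t, i < a) :
    (insert a t).sort (· ≤ ·) = t.sort (· ≤ ·) ++ [a] := by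
  have ha : a ∉ t := fun h' => lt_irrefl a (h a h')
  refine List.Perm.eq_of_pairwise' (r := (· ≤ ·)) (Finset.pairwise_sort _ _) ?_ ?_
  · rw [List.pairwise_append]
    refine ⟨Finset.pairwise_sort _ _, List.pairwise_singleton _ _, fun x hx y hy => ?_⟩
    rw [List.mem_singleton.mp hy]
    exact (h x (by simpa using hx)).le
  · rw [List.perm_ext_iff_of_nodup (Finset.sort_nodup _ _)]
    · intro x; simp [or_comm]
    · rw [List.nodup_append]
      refine ⟨Finset.sort_nodup _ _, List.nodup_singleton _, fun x hx y hy => ?_⟩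
      rw [List.mem_singleton.mp hy]
      exact (h x (by simpa using hx)).ne

lemma IsGeneric.isRegularMod_of_lt {c : ℕ} {f : Fin s → R} (hf : IsGeneric c f)
    {t : Finset (Fin s)} {a : Fin s} (h : ∀ i ∈ t, i < a) (hc : t.card ≤ c) :
    IsRegularMod (Ideal.span (f '' (t : Set (Fin s)))) (f a) := by
  have ha : a ∉ t := fun h' => lt_irrefl a (h a h')
  have h1 := (hf (insert a t) (by rw [Finset.card_insert_of_notMem ha]; omega)).toIsWeaklyRegular
  rw [sort_insert_of_lt h, List.map_append, RingTheory.Sequence.isWeaklyRegular_append_iff] at h1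
  have h2 := h1.2
  rw [List.map_singleton, RingTheory.Sequence.isWeaklyRegular_singleton_iff,
    isSMulRegular_quotient_iff_mem_of_smul_mem] at h2
  have h3 : Ideal.ofList ((t.sort (· ≤ ·)).map f) • (⊤ : Submodule R R) =
      Ideal.span (f '' (t : Set (Fin s))) := by
    rw [smul_eq_mul, Ideal.mul_top, Ideal.ofList]
    congr 1
    ext x
    simp
  rw [h3] at h2
  exact h2

lemma IsGeneric.isRegularMod {c : ℕ} {f : Fin s → R} (hf : IsGeneric c f)
    {t : Finset (Fin s)} {j : Fin s} (hj : j ∉ t) (hc : t.card ≤ c) :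
    IsRegularMod (Ideal.span (f '' (t : Set (Fin s)))) (f j) := by
  induction t using Finset.induction_on_max generalizing j with
  | empty => exact hf.isRegularMod_of_lt (by simp) hc
  | insert a t ha ih =>
    have hat : a ∉ t := fun h' => lt_irrefl a (ha a h')
    rw [Finset.mem_insert, not_or] at hj
    rw [Finset.card_insert_of_notMem hat] at hc
    -- Genericity only speaks of increasing order. For `j` below the maximum `a`, both `f j` modulo
    -- `t` and `f a` modulo `insert j t` are regular, and `swap` applies.
    rcases lt_or_gt_of_ne hj.1 with hlt | hgt
    · rw [span_image_insert, sup_comm]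
      refine (ih hj.2 (by omega)).swap ?_
      rw [sup_comm, ← span_image_insert]
      refine hf.isRegularMod_of_lt ?_ (by rw [Finset.card_insert_of_notMem hj.2]; omega)
      intro i hi
      rcases Finset.mem_insert.mp hi with rfl | hi
      exacts [hlt, ha i hi]
    · refine hf.isRegularMod_of_lt ?_ (by rw [Finset.card_insert_of_notMem hat]; omega)
      intro i hi
      rcases Finset.mem_insert.mp hi with rfl | hi
      exacts [hgt, (ha i hi).trans hgt]

lemma IsGeneric.isPermutablyRegularMod {c : ℕ} {f : Fin s → R} (hf : IsGeneric c f)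
    {t : Finset (Fin s)} (hc : t.card ≤ c + 1) : IsPermutablyRegularMod f ⊥ t := by
  intro t' ht' j hj hj'
  rw [bot_sup_eq]
  refine hf.isRegularMod hj' ?_
  have := Finset.card_lt_card (Finset.ssubset_iff_subset_ne.mpr ⟨ht', fun h => hj' (h ▸ hj)⟩)
  omega

end Generic

/-! ### The irrelevant ideal: depth and primes containing many forms. -/

section Polynomial

open MvPolynomial

variable {K σ : Type*} [Field K]

lemma isRegularMod_span_X_image {S : Set σ} {i : σ} (hi : i ∉ S) :
    IsRegularMod (Ideal.span (X '' S : Set (MvPolynomial σ K))) (X i) := by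
  intro u hu
  rw [mem_ideal_span_X_image] at hu ⊢
  intro m hm
  obtain ⟨j, hj, hne⟩ := hu (Finsupp.single i 1 + m) (by
    rwa [mem_support_iff, coeff_X_mul, ← mem_support_iff])
  refine ⟨j, hj, ?_⟩
  have : i ≠ j := fun h => hi (h ▸ hj)
  simpa [Finsupp.single_apply, this] using hne

lemma hasDepth_idealOfVars [Fintype σ] [DecidableEq σ] (k : ℕ) (t : Finset σ)
    (h : t.card + k = Fintype.card σ) :
    HasDepth (idealOfVars σ K) k (Ideal.span (X '' (t : Set σ))) := by
  induction k generalizing t with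
  | zero => trivial
  | succ k ih =>
    obtain ⟨i, hi⟩ : ∃ i, i ∉ t := by
      by_contra! hcon
      rw [Finset.eq_univ_iff_forall.mpr hcon, Finset.card_univ] at h
      omega
    refine ⟨X i, Ideal.subset_span ⟨i, rfl⟩, isRegularMod_span_X_image hi, ?_⟩
    rw [sup_comm, ← span_image_insert]
    exact ih _ (by rw [Finset.card_insert_of_notMem hi]; omega)

lemma idealOfVars_ne_top : idealOfVars σ K ≠ ⊤ := by
  intro h
  have h1 : (1 : MvPolynomial σ K) ∈ idealOfVars σ K := h ▸ Submodule.mem_top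
  rw [← pow_one (idealOfVars σ K), ← C_1, C_mem_pow_idealOfVars_iff] at h1
  simp at h1

/-- A homogeneous proper ideal lies in the irrelevant ideal. -/
lemma le_idealOfVars_of_homogeneousComponent_zero_mem {p : Ideal (MvPolynomial σ K)} (hp : p ≠ ⊤)
    (h : ∀ g ∈ p, homogeneousComponent 0 g ∈ p) : p ≤ idealOfVars σ K := by
  intro g hg
  have h0 : coeff 0 g = 0 := by
    by_contra hne
    have h1 := h g hg
    rw [homogeneousComponent_zero] at h1
    exact hp (Ideal.eq_top_of_isUnit_mem _ h1 ((isUnit_iff_ne_zero.mpr hne).map C))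
  rw [← pow_one (idealOfVars σ K), mem_pow_idealOfVars_iff']
  intro x hx
  rw [Nat.lt_one_iff, Finsupp.degree_eq_zero_iff] at hx
  rw [hx, h0]

/-- The homogeneous core of `p` is a prime containing the same `n + 1` forms, so its height is the
full dimension. It is therefore maximal, and being homogeneous it equals the irrelevant ideal. -/
lemma idealOfVars_le_of_isPrime {n s : ℕ} {f : Fin s → MvPolynomial (Fin (n + 1)) K}
    (hform : ∀ i, ∃ d : ℕ, (f i).IsHomogeneous d) (hgen : IsGeneric n f) {t : Finset (Fin s)}
    (ht : t.card = n + 1) {p : Ideal (MvPolynomial (Fin (n + 1)) K)} [hp : p.IsPrime]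
    (hfp : ∀ i ∈ t, f i ∈ p) : idealOfVars (Fin (n + 1)) K ≤ p := by
  let _ : GradedAlgebra (homogeneousSubmodule (Fin (n + 1)) K) := gradedAlgebra
  set q := (p.homogeneousCore (homogeneousSubmodule (Fin (n + 1)) K)).toIdeal
  have hqp : q ≤ p := Ideal.toIdeal_homogeneousCore_le _ p
  have hqprime : q.IsPrime := Ideal.IsPrime.homogeneousCore hp
  have hqm : q ≤ idealOfVars (Fin (n + 1)) K :=
    le_idealOfVars_of_homogeneousComponent_zero_mem hqprime.ne_top fun g hg =>
      homogeneousComponent_mem_of_mem (HomogeneousIdeal.isHomogeneous _) hg 0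
  have hfq : ∀ i ∈ t, f i ∈ q := by
    intro i hi
    obtain ⟨d, hd⟩ := hform i
    exact Ideal.mem_homogeneousCore_of_homogeneous_of_mem ⟨d, hd⟩ (hfp i hi)
  have h1 := (hgen.isPermutablyRegularMod ht.le).card_le_height hfq
  have hdim : ringKrullDim (MvPolynomial (Fin (n + 1)) K) = ((n + 1 : ℕ) : ℕ∞) := by
    rw [ringKrullDim_of_isNoetherianRing, ringKrullDim_eq_zero_of_field, zero_add, Nat.card_fin]
    rfl
  have : FiniteRingKrullDim (MvPolynomial (Fin (n + 1)) K) := by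
    rw [finiteRingKrullDim_iff_ne_bot_and_top, hdim]
    exact ⟨WithBot.coe_ne_bot, fun h => ENat.natCast_ne_top _ (WithBot.coe_injective h)⟩
  have hmax : q.IsMaximal := by
    refine Ideal.isMaximal_of_height_eq_ringKrullDim
      (le_antisymm Ideal.height_le_ringKrullDim_of_isPrime ?_)
    rw [ht] at h1
    rw [hdim]
    exact WithBot.coe_le_coe.mpr h1
  rw [← hmax.eq_of_le idealOfVars_ne_top hqm]
  exact hqp

end Polynomial

/-! ### Passing between partial and full fold products. -/

section FoldProducts

variable {R ι : Type*} [CommRing R] {s : ℕ}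

lemma exists_le_sum_eq [DecidableEq ι] (t : Finset ι) (e : ι → ℕ) {a : ℕ} (ha : a ≤ ∑ i ∈ t, e i) :
    ∃ e' : ι → ℕ, (∀ i, e' i ≤ e i) ∧ ∑ i ∈ t, e' i = a := by
  induction a with
  | zero => exact ⟨0, by simp⟩
  | succ a ih =>
    obtain ⟨e', he', hsum⟩ := ih (by omega)
    obtain ⟨i, hi, hlt⟩ := Finset.exists_lt_of_sum_lt (hsum.trans_lt (Nat.lt_of_succ_le ha))
    refine ⟨fun j => e' j + if j = i then 1 else 0, fun j => ?_, ?_⟩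
    · have := he' j
      by_cases h : j = i
      · subst h
        simpa using hlt
      · simpa [h] using this
    · rw [Finset.sum_add_distrib, hsum, Finset.sum_ite_eq' t i, if_pos hi]

lemma prod_pow_mem_foldProductIdeal (f : Fin s → R) {m e : Fin s → ℕ} {a : ℕ} (he : ∀ i, e i ≤ m i)
    (ha : a ≤ ∑ i, e i) : ∏ i, f i ^ e i ∈ foldProductIdeal f m a := by
  obtain ⟨e', he', hsum⟩ := exists_le_sum_eq Finset.univ e ha
  have h1 : ∏ i, f i ^ e' i ∈ foldProductIdeal f m a :=
    Ideal.subset_span ⟨e', fun i => (he' i).trans (he i), hsum, rfl⟩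
  exact Ideal.mem_of_dvd _ (Finset.prod_dvd_prod_of_dvd _ _ fun i _ => pow_dvd_pow _ (he' i)) h1

lemma mul_prod_compl_mem_foldProductIdeal {f : Fin s → R} {m : Fin s → ℕ} {a : ℕ}
    {t : Finset (Fin s)} {g : R} (hg : g ∈ partialFoldIdeal f m t (mu m a t)) :
    g * ∏ i ∈ tᶜ, f i ^ m i ∈ foldProductIdeal f m a := by
  induction hg using Submodule.span_induction with
  | zero => simp
  | add x y _ _ hx hy => rw [add_mul]; exact Ideal.add_mem _ hx hy
  | smul c x _ hx => rw [smul_eq_mul, mul_assoc]; exact Ideal.mul_mem_left _ _ hx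
  | mem g hg =>
    obtain ⟨e, he, hsum, rfl⟩ := hg
    have h1 : ∀ i ∈ t, (if i ∈ t then e i else m i) = e i := fun i hi => if_pos hi
    have h2 : ∀ i ∈ tᶜ, (if i ∈ t then e i else m i) = m i :=
      fun i hi => if_neg (Finset.mem_compl.mp hi)
    have h3 : (∏ i ∈ t, f i ^ e i) * ∏ i ∈ tᶜ, f i ^ m i =
        ∏ i, f i ^ (if i ∈ t then e i else m i) := by
      rw [← Finset.prod_mul_prod_compl t]
      congr 1
      · exact Finset.prod_congr rfl fun i hi => by rw [h1 i hi]
      · exact Finset.prod_congr rfl fun i hi => by rw [h2 i hi]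
    rw [h3]
    refine prod_pow_mem_foldProductIdeal f (fun i => ?_) ?_
    · split_ifs with h
      exacts [he i h, le_rfl]
    · rw [← Finset.sum_add_sum_compl t, Finset.sum_congr rfl h1, Finset.sum_congr rfl h2, hsum]
      exact le_tsub_add

lemma foldProductIdeal_le_span_pow (f : Fin s → R) (m : Fin s → ℕ) (a : ℕ) (t : Finset (Fin s)) :
    foldProductIdeal f m a ≤ Ideal.span (f '' (t : Set (Fin s))) ^ mu m a t := by
  have h := partialFoldIdeal_le_span_pow f m (Finset.subset_univ t) a
  rw [← Finset.compl_eq_univ_sdiff] at h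
  refine le_trans (Ideal.span_mono ?_) h
  rintro g ⟨e, he, hsum, rfl⟩
  exact ⟨e, fun i _ => he i, hsum, rfl⟩

end FoldProducts

/-! ### Saturated powers and the complementary products. -/

section Saturation

open MvPolynomial

variable {K σ : Type*} [Field K]

lemma saturation_le {I Q : Ideal (MvPolynomial σ K)} (hIQ : I ≤ Q)
    (hQ : IsSaturatedBy (idealOfVars σ K) Q) : saturation I ≤ Q := by
  refine iSup_le fun k g hg => ?_
  have hg' : ∀ p ∈ idealOfVars σ K ^ k, g * p ∈ Q :=
    fun p hp => hIQ (Submodule.mem_colon.mp hg p hp)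
  clear hg
  induction k with
  | zero => simpa using hg' 1 (by simp)
  | succ k ih =>
    refine ih fun p hp => hQ _ fun h hh => ?_
    have := hg' (p * h) (by rw [pow_succ]; exact Ideal.mul_mem_mul hp hh)
    rwa [mul_comm h, mul_assoc]

lemma IsGeneric.isSaturatedBy_span_pow {n s : ℕ} {f : Fin s → MvPolynomial (Fin (n + 1)) K}
    (hgen : IsGeneric n f) {t : Finset (Fin s)} (ht : t.card ≤ n) (k : ℕ) :
    IsSaturatedBy (idealOfVars (Fin (n + 1)) K) (Ideal.span (f '' (t : Set (Fin s))) ^ k) := by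
  have hN := hgen.isPermutablyRegularMod (t := t) (by omega)
  -- The depth `n + 1` is split so that a successor, hence positive depth, remains after quotienting
  -- by `t.card` elements.
  have hdep : HasDepth (idealOfVars (Fin (n + 1)) K) (t.card + (n - t.card + 1)) ⊥ := by
    have := hasDepth_idealOfVars (K := K) (σ := Fin (n + 1)) (t.card + (n - t.card + 1)) ∅ (by
      rw [Finset.card_empty, Fintype.card_fin]
      omega)
    rwa [span_image_empty] at this
  have := hN.isSaturatedBy_pow (hN.hasDepth hdep).isSaturatedBy k
  rwa [bot_sup_eq] at this

/-- The products `∏ i ∉ t, f i ^ m i` with `|t| ≤ n` generate an ideal that is the unit ideal or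
primary to the irrelevant ideal. -/
lemma IsGeneric.idealOfVars_le_radical {n s : ℕ} {f : Fin s → MvPolynomial (Fin (n + 1)) K}
    (hform : ∀ i, ∃ d : ℕ, (f i).IsHomogeneous d) (hgen : IsGeneric n f) (m : Fin s → ℕ) :
    idealOfVars (Fin (n + 1)) K ≤
      (Ideal.span {g | ∃ t : Finset (Fin s), t.card ≤ n ∧ g = ∏ i ∈ tᶜ, f i ^ m i}).radical := by
  classical
  rw [Ideal.radical_eq_sInf]
  refine le_sInf ?_
  rintro p ⟨hle, hp⟩
  set T := Finset.univ.filter fun i => f i ∈ p with hT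
  rcases Nat.lt_or_ge n T.card with hlt | hge
  · obtain ⟨t, htT, ht⟩ := Finset.exists_subset_card_eq (Nat.succ_le_of_lt hlt)
    exact idealOfVars_le_of_isPrime hform hgen ht fun i hi => (Finset.mem_filter.mp (htT hi)).2
  · exfalso
    have h1 : ∏ i ∈ Tᶜ, f i ^ m i ∈ p := hle (Ideal.subset_span ⟨T, hge, rfl⟩)
    obtain ⟨i, hi, hip⟩ := (Ideal.IsPrime.prod_mem_iff (hp := hp)).mp h1
    exact Finset.mem_compl.mp hi (by simpa [hT] using hp.mem_of_pow_mem _ hip)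

end Saturation
end FoldProduct

theorem mainTheorem2 {K : Type*} [Field K] (n s : ℕ)
    (f : Fin s → MvPolynomial (Fin (n + 1)) K)
    (hform : ∀ i, ∃ d : ℕ, (f i).IsHomogeneous d)
    (hgen : FoldProduct.IsGeneric n f)
    (a : ℕ) (m : Fin s → ℕ) (ha : 0 < a) (hm : ∀ i, 0 < m i) (ham : a ≤ ∑ i, m i) :
    FoldProduct.saturation (FoldProduct.foldProductIdeal f m a) =
      ⨅ c ∈ Set.Icc 1 n, ⨅ t : Finset (Fin s), ⨅ _ : t.card = c,
        Ideal.span (f '' (t : Set (Fin s))) ^ FoldProduct.mu m a t := by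
  refine le_antisymm ?_ fun g hg => ?_
  · refine le_iInf fun c => le_iInf fun hc => le_iInf fun t => le_iInf fun ht => ?_
    exact FoldProduct.saturation_le (FoldProduct.foldProductIdeal_le_span_pow f m a t)
      (hgen.isSaturatedBy_span_pow (ht ▸ hc.2) _)
  · have hg' (t : Finset (Fin s)) (ht : t.card ≤ n) :
        g ∈ Ideal.span (f '' (t : Set (Fin s))) ^ FoldProduct.mu m a t := by
      -- The intersection omits `t = ∅`, where `ham` makes the exponent zero.
      rcases t.eq_empty_or_nonempty with rfl | hne
      · have : FoldProduct.mu m a ∅ = 0 := by simpa [FoldProduct.mu, Nat.sub_eq_zero_iff_le] using ham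
        simp [this]
      · simp only [Submodule.mem_iInf] at hg
        exact hg t.card ⟨hne.card_pos, ht⟩ t rfl
    have hmul (t : Finset (Fin s)) (ht : t.card ≤ n) :
        g * ∏ i ∈ tᶜ, f i ^ m i ∈ FoldProduct.foldProductIdeal f m a := by
      refine FoldProduct.mul_prod_compl_mem_foldProductIdeal ?_
      rw [← bot_sup_eq (FoldProduct.partialFoldIdeal f m t _)]
      refine (hgen.isPermutablyRegularMod (by omega)).mem_sup_partialFoldIdeal fun t' ht' => ?_
      rw [bot_sup_eq]
      convert hg' t' ((Finset.card_le_card ht').trans ht) using 2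
      -- The exponents agree: removing the weights outside `t` and then those in `t \ t'` removes
      -- all weights outside `t'`.
      have : t'ᶜ = tᶜ ∪ t \ t' := by
        ext i
        have := @ht' i
        simp only [Finset.mem_compl, Finset.mem_union, Finset.mem_sdiff]
        tauto
      rw [FoldProduct.mu, FoldProduct.mu, this, Finset.sum_union, Nat.sub_sub]
      exact Finset.disjoint_left.mpr fun i hi hi' =>
        Finset.mem_compl.mp hi (Finset.mem_sdiff.mp hi').1
    obtain ⟨k, hk⟩ := Ideal.exists_pow_le_of_le_radical_of_fg
      (FoldProduct.IsGeneric.idealOfVars_le_radical hform hgen m)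
      (MvPolynomial.idealOfVars_fg (Fin (n + 1)) K)
    refine Submodule.mem_iSup_of_mem k (Submodule.mem_colon.mpr fun p hp => ?_)
    have hp' := hk hp
    clear hp
    rw [smul_eq_mul]
    induction hp' using Submodule.span_induction with
    | zero => simp
    | add x y _ _ hx hy => rw [mul_add]; exact Ideal.add_mem _ hx hy
    | smul c x _ hx => rw [smul_eq_mul, mul_left_comm]; exact Ideal.mul_mem_left _ _ hx
    | mem x hx =>
      obtain ⟨t, ht, rfl⟩ := hx
      exact hmul t ht
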